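/- For a positive integer $m$ let $z_m$ denote the optimal value of the linear program \[ \max\ \sum_{k=1}^m \varphi(k)\,x_k \quad\text{subject to}\quad x_k + x_\ell \le \frac{2}{k\ell}\ \ (k,\ell = 1,\dots,m),\qquad x \in \mathbb{R}^m,\ x\ge 0, \] where $\varphi$ is Euler's totient function. Its dual is the linear program \[ (D_m)\qquad \min\ \sum_{k,\ell=1}^m \frac{2}{k\ell}\,Y_{k,\ell} \quad\text{subject to}\quad \sum_{\ell=1}^m (Y_{k,\ell}+Y_{\ell,k}) \ge \varphi(k)\ \ (k=1,\dots,m),\qquad Y\in\mathbb{R}^{m\times m},\ Y\ge 0. \] Then, for every integer $m\ge 4$, both optimal values are attained and both are equal to $z_m$, and \[ z_m \le 0.999 . \] -/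

import Mathlib

namespace GenericLP

/-- The index `k : Fin m` stands for the positive integer `k + 1`, which runs through `1, …, m`. -/
def idx {m : ℕ} (k : Fin m) : ℕ := (k : ℕ) + 1

/-- Feasible points of the primal program:
`x ≥ 0` and `x_k + x_ℓ ≤ 2 / (k ℓ)` for all `k, ℓ = 1, …, m` (including `k = ℓ`). -/
def PrimalFeasible (m : ℕ) (x : Fin m → ℝ) : Prop :=
  (∀ k, 0 ≤ x k) ∧ ∀ k l, x k + x l ≤ 2 / ((idx k : ℝ) * (idx l : ℝ))

/-- The primal objective `∑ φ(k) x_k`. -/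
def primalObjective (m : ℕ) (x : Fin m → ℝ) : ℝ :=
  ∑ k, (Nat.totient (idx k) : ℝ) * x k

/-- The set of objective values of feasible points of the primal program. -/
def primalValues (m : ℕ) : Set ℝ :=
  {v | ∃ x, PrimalFeasible m x ∧ primalObjective m x = v}

/-- Feasible points of the dual program:
`Y ≥ 0` and `∑_ℓ (Y_{k,ℓ} + Y_{ℓ,k}) ≥ φ(k)` for all `k = 1, …, m`. -/
def DualFeasible (m : ℕ) (Y : Matrix (Fin m) (Fin m) ℝ) : Prop :=
  (∀ k l, 0 ≤ Y k l) ∧ ∀ k, (Nat.totient (idx k) : ℝ) ≤ ∑ l, (Y k l + Y l k)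

/-- The dual objective `∑_{k,ℓ} 2 / (k ℓ) · Y_{k,ℓ}`. -/
noncomputable def dualObjective (m : ℕ) (Y : Matrix (Fin m) (Fin m) ℝ) : ℝ :=
  ∑ k, ∑ l, 2 / ((idx k : ℝ) * (idx l : ℝ)) * Y k l

/-- The set of objective values of feasible points of the dual program. -/
def dualValues (m : ℕ) : Set ℝ :=
  {v | ∃ Y, DualFeasible m Y ∧ dualObjective m Y = v}

/-- The optimal value `z_m` of the primal (maximization) program. -/
noncomputable def optValue (m : ℕ) : ℝ := sSup (primalValues m)

end GenericLP

/-!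
The optimum of the primal program is attained because its feasible set is compact. Strong duality
is the usual separation argument under Slater's condition: all right-hand sides `2 / (k l)` are
positive, so `x = 0` is strictly feasible, and a hyperplane separating the point `(0, z_m)` from the
open convex set of perturbed values (`perturbedValues`) yields a dual point of value at most `z_m`
(`exists_dualFeasible_le_optValue`). No closedness of a finitely generated cone is needed.

For the bound on `z_m`, call `k, l ≤ m` a Farey pair if they are coprime and `k + l > m`. Each `k`
has exactly `φ(k)` partners, since these are the numbers coprime to `k` in an interval of length
`k`, and `∑ 1 / (k l) = 1` over all Farey pairs, by induction on `m` through mediants. Summing the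
primal constraints over the Farey pairs thus gives `z_m ≤ 1`, and more precisely the distance from
`1` is half of the total slack of these constraints (`sum_slack_fareyPairs`). The slack cannot vanish
everywhere: if `k < k'` and `l < l'`, the pairs `(k, l)` and `(k', l')` together have slack at least
`2 (1 / k - 1 / k') (1 / l - 1 / l')`, because the constraints for `(k, l')` and `(k', l)` bound the
same four variables (`two_mul_le_slack_add_slack`). Using this for pairs just above `m / 2` against
pairs just below `m`, of which a positive proportion is coprime (`le_card_coprimeBox`), yields a
total gain above `0.001` as soon as `m ≥ 176` (`sum_totient_mul_le_of_large`).

For `4 ≤ m < 176` the multiset in which every `k ≤ m` occurs `φ(k)` times is matched with itself in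
the opposite order, and the resulting sum of constraints is evaluated in integer arithmetic
(`pairingCost_bound_small`).
-/

namespace GenericLP

/-! ### Attainment and strong duality -/

theorem one_le_idx {m : ℕ} (k : Fin m) : 1 ≤ idx k := Nat.succ_le_succ (Nat.zero_le _)

theorem constraint_pos {m : ℕ} (k l : Fin m) : 0 < 2 / ((idx k : ℝ) * (idx l : ℝ)) := by
  have hk : (0 : ℝ) < idx k := by exact_mod_cast one_le_idx k
  have hl : (0 : ℝ) < idx l := by exact_mod_cast one_le_idx l
  positivity

theorem isCompact_primalFeasible (m : ℕ) : IsCompact {x | PrimalFeasible m x} := by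
  apply (isCompact_Icc (a := (0 : Fin m → ℝ))
    (b := fun k => 2 / ((idx k : ℝ) * (idx k : ℝ)))).of_isClosed_subset
  · simp only [PrimalFeasible, Set.ofPred_and, Set.ofPred_forall]
    refine IsClosed.inter ?_ ?_
    · exact isClosed_iInter fun k => isClosed_le (by fun_prop) (by fun_prop)
    · exact isClosed_iInter fun k => isClosed_iInter fun l =>
        isClosed_le (by fun_prop) (by fun_prop)
  · rintro x ⟨h0, h1⟩
    exact ⟨fun k => h0 k, fun k => by have := h1 k k; have := h0 k; linarith⟩

theorem primalFeasible_zero (m : ℕ) : PrimalFeasible m 0 :=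
  ⟨fun _ => le_rfl, fun k l => by simpa using (constraint_pos k l).le⟩

theorem isGreatest_optValue (m : ℕ) : IsGreatest (primalValues m) (optValue m) := by
  have h : primalValues m = primalObjective m '' {x | PrimalFeasible m x} := rfl
  rw [optValue, h]
  refine IsCompact.isGreatest_sSup ?_ ⟨_, 0, primalFeasible_zero m, rfl⟩
  refine (isCompact_primalFeasible m).image ?_
  unfold primalObjective
  fun_prop

/-- The bilinear form pairing the constraints with `Y`, rearranged by variables. -/
theorem sum_mul_add_transpose {m : ℕ} (x : Fin m → ℝ) (Y : Matrix (Fin m) (Fin m) ℝ) :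
    ∑ k, ∑ l, (x k + x l) * Y k l = ∑ k, (∑ l, (Y k l + Y l k)) * x k := by
  have h : ∑ k, ∑ l, x l * Y k l = ∑ k, ∑ l, x k * Y l k := Finset.sum_comm
  simp only [add_mul, Finset.sum_add_distrib, h, Finset.sum_mul]
  simp only [mul_comm]

theorem weak_duality {m : ℕ} {x : Fin m → ℝ} {Y : Matrix (Fin m) (Fin m) ℝ}
    (hx : PrimalFeasible m x) (hY : DualFeasible m Y) :
    primalObjective m x ≤ dualObjective m Y := by
  calc primalObjective m x ≤ ∑ k, (∑ l, (Y k l + Y l k)) * x k :=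
        Finset.sum_le_sum fun k _ => mul_le_mul_of_nonneg_right (hY.2 k) (hx.1 k)
    _ = ∑ k, ∑ l, (x k + x l) * Y k l := (sum_mul_add_transpose x Y).symm
    _ ≤ dualObjective m Y := Finset.sum_le_sum fun k _ => Finset.sum_le_sum fun l _ =>
        mul_le_mul_of_nonneg_right (hx.2 k l) (hY.1 k l)

/-- The pairs `(b, r)` such that, after the right-hand sides of the primal constraints have been
relaxed by `b`, some nonnegative point satisfies them strictly and has objective value above `r`. -/
def perturbedValues (m : ℕ) : Set (Matrix (Fin m) (Fin m) ℝ × ℝ) :=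
  {p | ∃ x : Fin m → ℝ, (∀ k, 0 ≤ x k) ∧
    (∀ k l, x k + x l < 2 / ((idx k : ℝ) * (idx l : ℝ)) + p.1 k l) ∧ p.2 < primalObjective m x}

theorem isOpen_perturbedValues (m : ℕ) : IsOpen (perturbedValues m) := by
  have h : perturbedValues m = ⋃ x ∈ {x : Fin m → ℝ | ∀ k, 0 ≤ x k},
      (⋂ k, ⋂ l, {p : Matrix (Fin m) (Fin m) ℝ × ℝ |
        x k + x l < 2 / ((idx k : ℝ) * (idx l : ℝ)) + p.1 k l}) ∩
      {p | p.2 < primalObjective m x} := by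
    ext p
    simp only [perturbedValues, Set.mem_ofPred_eq, Set.mem_iUnion, Set.mem_inter_iff,
      Set.mem_iInter, exists_prop]
  rw [h]
  refine isOpen_biUnion fun x _ => IsOpen.inter ?_ (isOpen_lt (by fun_prop) (by fun_prop))
  refine isOpen_iInter_of_finite fun k => isOpen_iInter_of_finite fun l => ?_
  have : Continuous fun p : Matrix (Fin m) (Fin m) ℝ × ℝ => p.1 k l :=
    continuous_fst.matrix_elem k l
  exact isOpen_lt (by fun_prop) (by fun_prop)

theorem convex_perturbedValues (m : ℕ) : Convex ℝ (perturbedValues m) := by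
  rintro ⟨b, r⟩ ⟨x, hx, hb, hr⟩ ⟨b', r'⟩ ⟨x', hx', hb', hr'⟩ s t hs ht hst
  have combine : ∀ {u v u' v' : ℝ}, u < v → u' < v' → s * u + t * u' < s * v + t * v' := by
    intro u v u' v' h h'
    rcases hs.eq_or_lt with rfl | hs
    · obtain rfl : t = 1 := by linarith
      linarith
    · have := mul_lt_mul_of_pos_left h hs
      have := mul_le_mul_of_nonneg_left h'.le ht
      linarith
  refine ⟨s • x + t • x', fun k => ?_, fun k l => ?_, ?_⟩
  · exact add_nonneg (mul_nonneg hs (hx k)) (mul_nonneg ht (hx' k))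
  · have := combine (hb k l) (hb' k l)
    have hc : s * (2 / ((idx k : ℝ) * (idx l : ℝ))) + t * (2 / ((idx k : ℝ) * (idx l : ℝ))) =
        2 / ((idx k : ℝ) * (idx l : ℝ)) := by rw [← add_mul, hst, one_mul]
    simp only [Pi.add_apply, Pi.smul_apply, smul_eq_mul, Prod.fst_add, Prod.smul_fst,
      Matrix.add_apply, Matrix.smul_apply] at this ⊢
    linarith
  · have := combine hr hr'
    have ho : primalObjective m (s • x + t • x') =
        s * primalObjective m x + t * primalObjective m x' := by
      simp only [primalObjective, Pi.add_apply, Pi.smul_apply, smul_eq_mul, Finset.mul_sum,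
        ← Finset.sum_add_distrib]
      exact Finset.sum_congr rfl fun k _ => by ring
    simpa [ho] using this

theorem zero_optValue_notMem_perturbedValues (m : ℕ) :
    (0, optValue m) ∉ perturbedValues m := by
  rintro ⟨x, hx, hb, hr⟩
  refine absurd ((isGreatest_optValue m).2 ⟨x, ⟨hx, fun k l => ?_⟩, rfl⟩) (not_le.2 hr)
  simpa using (hb k l).le

/-- Strong duality. The separating functional of the open convex set `perturbedValues m` and the
point `(0, z_m)` has positive coefficient at the objective value, because `x = 0` satisfies every
constraint strictly; its remaining coefficients, rescaled, are a dual optimum. -/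
theorem exists_dualFeasible_le_optValue (m : ℕ) :
    ∃ Y, DualFeasible m Y ∧ dualObjective m Y ≤ optValue m := by
  obtain ⟨f, hf⟩ := geometric_hahn_banach_open_point (convex_perturbedValues m)
    (isOpen_perturbedValues m) (zero_optValue_notMem_perturbedValues m)
  set c := f (0, 1) with hc
  have hsplit : ∀ b r, f (b, r) = f (b, 0) + r * c := by
    intro b r
    rw [hc, ← smul_eq_mul, ← map_smul, ← map_add]
    simp
  have hz : f (0, optValue m) = optValue m * c := by
    rw [hsplit, show ((0 : Matrix (Fin m) (Fin m) ℝ), (0 : ℝ)) = 0 from rfl, map_zero, zero_add]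
  have hmem0 : ∀ r < 0, ((0 : Matrix (Fin m) (Fin m) ℝ), r) ∈ perturbedValues m := fun r hr =>
    ⟨0, fun _ => le_rfl, fun k l => by simpa using constraint_pos k l,
      by simpa [primalObjective] using hr⟩
  have hopt : 0 ≤ optValue m :=
    (isGreatest_optValue m).2 ⟨0, primalFeasible_zero m, by simp [primalObjective]⟩
  have hcpos : 0 < c := by
    have h := hf _ (hmem0 (-1) (by norm_num))
    rw [hz, hsplit, show ((0 : Matrix (Fin m) (Fin m) ℝ), (0 : ℝ)) = 0 from rfl, map_zero] at h
    nlinarith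
  set Y : Matrix (Fin m) (Fin m) ℝ := fun k l => -f (Matrix.single k l 1, 0) / c with hY
  have hfY : ∀ b, f (b, 0) = -c * ∑ k, ∑ l, b k l * Y k l := by
    intro b
    have hb : (b, (0 : ℝ)) = ∑ k, ∑ l, b k l • (Matrix.single k l (1 : ℝ), (0 : ℝ)) := by
      conv_lhs => rw [Matrix.matrix_eq_sum_single b]
      simp [Prod.ext_iff, Prod.fst_sum, Prod.snd_sum, Matrix.smul_single]
    rw [hb]
    simp only [map_sum, map_smul, smul_eq_mul, hY, Finset.mul_sum]
    refine Finset.sum_congr rfl fun k _ => Finset.sum_congr rfl fun l _ => ?_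
    field_simp
  -- Closing up the strict inequalities defining `perturbedValues m` gives weak ones for `f`.
  have key : ∀ (x : Fin m → ℝ) (b : Matrix (Fin m) (Fin m) ℝ), (∀ k, 0 ≤ x k) →
      (∀ k l, x k + x l ≤ 2 / ((idx k : ℝ) * (idx l : ℝ)) + b k l) →
      primalObjective m x ≤ optValue m + ∑ k, ∑ l, b k l * Y k l := by
    intro x b hx hb
    set J : Matrix (Fin m) (Fin m) ℝ := Matrix.of fun _ _ => 1 with hJ
    set T := ∑ k, ∑ l, J k l * Y k l
    have hε : ∀ ε > 0, primalObjective m x - ε ≤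
        optValue m + ∑ k, ∑ l, b k l * Y k l + ε * T := by
      intro ε hε
      have h := hf (b + ε • J, primalObjective m x - ε) ⟨x, hx, fun k l => by
        have := hb k l
        have hJε : (b + ε • J) k l = b k l + ε := by simp [hJ]
        simp only [hJε]
        linarith, by simpa using hε⟩
      have hs : ∑ k, ∑ l, (b + ε • J) k l * Y k l = ∑ k, ∑ l, b k l * Y k l + ε * T := by
        simp only [T, Matrix.add_apply, Matrix.smul_apply, smul_eq_mul, add_mul,
          Finset.sum_add_distrib, Finset.mul_sum, mul_assoc]
      rw [hz, hsplit, hfY, hs] at h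
      by_contra! hcon
      nlinarith [mul_lt_mul_of_pos_left hcon hcpos]
    have hlim : ∀ v w : ℝ, (∀ ε > 0, v - ε ≤ w + ε * T) → v ≤ w := by
      intro v w h
      refine le_of_forall_pos_le_add fun δ hδ => ?_
      have hpos : 0 < 1 + |T| := by positivity
      have h1 := h (δ / (1 + |T|)) (by positivity)
      have h2 : δ / (1 + |T|) * (1 + |T|) = δ := by field_simp
      have h3 : δ / (1 + |T|) * T ≤ δ / (1 + |T|) * |T| :=
        mul_le_mul_of_nonneg_left (le_abs_self T) (by positivity)
      linarith
    exact hlim _ _ hε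
  refine ⟨Y, ⟨fun k l => ?_, fun k => ?_⟩, ?_⟩
  · -- Relaxing a single constraint by an arbitrary amount forces its multiplier to be nonnegative.
    by_contra! hneg
    set t := (optValue m + 1) / -Y k l with ht
    have ht0 : 0 ≤ t := div_nonneg (by linarith) (by linarith)
    have htY : t * Y k l = -(optValue m + 1) := by
      rw [ht, div_mul_eq_mul_div, div_neg, mul_div_assoc, div_self hneg.ne, mul_one]
    have h := key 0 (Matrix.single k l t) (fun _ => le_rfl) (fun i j => by
      have h1 := constraint_pos i j
      have h2 : 0 ≤ Matrix.single k l t i j := by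
        rw [Matrix.single_apply]; split_ifs <;> simp [ht0]
      simp only [Pi.zero_apply]; linarith)
    have hs : ∑ i, ∑ j, Matrix.single k l t i j * Y i j = t * Y k l := by
      rw [Finset.sum_eq_single k, Finset.sum_eq_single l]
      · simp
      · intro j _ hj; simp [Ne.symm hj]
      · simp
      · intro i _ hi; simp [Ne.symm hi]
      · simp
    rw [hs, htY] at h
    simp [primalObjective] at h
    linarith
  · -- Testing with large multiples of the `k`-th unit vector gives the `k`-th dual constraint.
    by_contra! hlt
    set d := (Nat.totient (idx k) : ℝ) - ∑ l, (Y k l + Y l k) with hd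
    have hd0 : 0 < d := by linarith
    set D := dualObjective m Y with hD
    have hray : ∀ t ≥ 0, t * d ≤ optValue m - D := by
      intro t ht
      have h := key (Pi.single k t)
        (fun i j => Pi.single (M := fun _ => ℝ) k t i + Pi.single (M := fun _ => ℝ) k t j
          - 2 / ((idx i : ℝ) * (idx j : ℝ)))
        (fun i => by rw [Pi.single_apply]; split_ifs <;> simp [ht]) (fun i j => by linarith)
      simp only [sub_mul, Finset.sum_sub_distrib] at h
      rw [sum_mul_add_transpose] at h
      have e1 : primalObjective m (Pi.single k t) = Nat.totient (idx k) * t := by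
        simp [primalObjective, Pi.single_apply]
      have e2 : ∑ i, (∑ l, (Y i l + Y l i)) * Pi.single (M := fun _ => ℝ) k t i =
          (∑ l, (Y k l + Y l k)) * t := by
        simp [Pi.single_apply]
      rw [e1, e2] at h
      have e3 : ∑ i, ∑ j, 2 / ((idx i : ℝ) * (idx j : ℝ)) * Y i j = D := rfl
      rw [e3] at h
      rw [hd]; linarith
    have h0 := hray 0 le_rfl
    have h1 := hray ((optValue m - D + 1) / d) (div_nonneg (by linarith) hd0.le)
    rw [div_mul_cancel₀ _ hd0.ne'] at h1
    linarith
  · have h := key 0 (fun i j => -(2 / ((idx i : ℝ) * (idx j : ℝ)))) (fun _ => le_rfl)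
      (fun i j => by simp)
    simp only [neg_mul, Finset.sum_neg_distrib] at h
    have h0 : primalObjective m 0 = 0 := by simp [primalObjective]
    rw [h0] at h
    unfold dualObjective
    linarith

theorem isLeast_dualValues (m : ℕ) : IsLeast (dualValues m) (optValue m) := by
  obtain ⟨x, hx, hxv⟩ := (isGreatest_optValue m).1
  refine ⟨?_, ?_⟩
  · obtain ⟨Y, hY, hYv⟩ := exists_dualFeasible_le_optValue m
    exact ⟨Y, hY, le_antisymm hYv (hxv ▸ weak_duality hx hY)⟩
  · rintro v ⟨Y, hY, rfl⟩
    exact hxv ▸ weak_duality hx hY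

/-! ### The constraints for sequences -/

/-- The primal constraints for a real sequence `X`, of which only `X 1, …, X m` matter; the sign
constraint is left out. -/
def PairBounded (m : ℕ) (X : ℕ → ℝ) : Prop :=
  ∀ k ∈ Finset.Icc 1 m, ∀ l ∈ Finset.Icc 1 m, X k + X l ≤ 2 / ((k : ℝ) * l)

/-! ### Greedy matching for small `m` -/

/-- The contribution of runs that find no partner, from `X k ≤ 1 / k²`; see `pairingCost`. -/
def remainderCost (S : ℕ) (R : List (ℕ × ℕ)) : ℕ :=
  (R.map fun p => p.2 * S / (p.1 * p.1) + 1).sum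

/-- Lists of pairs `(k, a)` stand for sums `∑ a * X k`. The two lists are matched greedily from the
front, `min a b` units of `(k, a)` against as many of `(l, b)`, at `2 / (k l)` per unit. The first
argument is the unit of account: costs are in multiples of `1 / S` and rounded up (to `⌊·⌋ + 1`), so
that the computation stays in `ℕ`. The second argument bounds the number of steps; what is left
unmatched is charged by `remainderCost`. -/
def pairingCost (S : ℕ) : ℕ → List (ℕ × ℕ) → List (ℕ × ℕ) → ℕ
  | n + 1, p :: A, q :: B =>
    min p.2 q.2 * 2 * S / (p.1 * q.1) + 1 +
      if p.2 ≤ q.2 then pairingCost S n A ((q.1, q.2 - p.2) :: B)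
      else pairingCost S n ((p.1, p.2 - q.2) :: A) B
  | _, A, B => remainderCost S A + remainderCost S B

/-- The runs of the sum `∑ φ(k) X k` over `1 ≤ k ≤ m`. -/
def totientRuns (m : ℕ) : List (ℕ × ℕ) :=
  (List.range m).map fun i => (i + 1, Nat.totient (i + 1))

/-- Matching the list with its reversal pairs small denominators with large ones, which is the
cheapest coupling because `1 / (k l)` has positive mixed differences. Each unit occurs on both
sides, so the bound is twice `0.999`. -/
theorem pairingCost_bound_small : ∀ m < 176, 4 ≤ m →
    pairingCost 1000000 (2 * m) (totientRuns m) (totientRuns m).reverse ≤ 1998000 := by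
  decide +kernel

/-- The sum `∑ a * X k` over the runs `(k, a)` of a list. -/
def runsValue (X : ℕ → ℝ) (R : List (ℕ × ℕ)) : ℝ :=
  (R.map fun p => (p.2 : ℝ) * X p.1).sum

theorem runsValue_cons (X : ℕ → ℝ) (p : ℕ × ℕ) (R : List (ℕ × ℕ)) :
    runsValue X (p :: R) = p.2 * X p.1 + runsValue X R := by
  simp [runsValue]

theorem div_le_natDiv_add_one (a b : ℕ) (hb : 0 < b) : (a : ℝ) / b ≤ ((a / b + 1 : ℕ) : ℝ) := by
  rw [div_le_iff₀ (by exact_mod_cast hb)]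
  have := (Nat.lt_mul_div_succ a hb).le
  rw [mul_comm] at this
  exact_mod_cast this

theorem mul_runsValue_le_remainderCost {m : ℕ} {X : ℕ → ℝ} (hX : PairBounded m X) (S : ℕ)
    (R : List (ℕ × ℕ)) (hR : ∀ p ∈ R, p.1 ∈ Finset.Icc 1 m) :
    S * runsValue X R ≤ remainderCost S R := by
  induction R with
  | nil => simp [runsValue, remainderCost]
  | cons p R ih =>
    have ih := ih fun q hq => hR q (List.mem_cons_of_mem _ hq)
    have hp := hR p List.mem_cons_self
    have hpos : 0 < p.1 := (Finset.mem_Icc.1 hp).1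
    have h1 := hX _ hp _ hp
    have h2 := div_le_natDiv_add_one (p.2 * S) (p.1 * p.1) (by positivity)
    have h3 : S * (p.2 * X p.1) ≤ ((p.2 * S : ℕ) : ℝ) / ((p.1 * p.1 : ℕ) : ℝ) := by
      have : X p.1 ≤ 1 / ((p.1 : ℝ) * p.1) := by
        have : 2 / ((p.1 : ℝ) * p.1) = 2 * (1 / ((p.1 : ℝ) * p.1)) := by ring
        linarith
      calc S * (p.2 * X p.1) ≤ S * (p.2 * (1 / ((p.1 : ℝ) * p.1))) := by gcongr
        _ = _ := by push_cast; ring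
    have hc : remainderCost S (p :: R) = (p.2 * S / (p.1 * p.1) + 1) + remainderCost S R := by
      simp [remainderCost]
    rw [runsValue_cons, hc]
    push_cast at h2 h3 ih ⊢
    linarith

/-- Every matched unit is one use of the constraint `X k + X l ≤ 2 / (k l)`. -/
theorem mul_runsValue_add_le_pairingCost {m : ℕ} {X : ℕ → ℝ} (hX : PairBounded m X) (S n : ℕ)
    (A B : List (ℕ × ℕ)) (hA : ∀ p ∈ A, p.1 ∈ Finset.Icc 1 m)
    (hB : ∀ p ∈ B, p.1 ∈ Finset.Icc 1 m) :
    S * (runsValue X A + runsValue X B) ≤ pairingCost S n A B := by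
  induction n, A, B using pairingCost.induct with
  | case1 n p A q B ihA ihB =>
    have hp := hA p List.mem_cons_self
    have hq := hB q List.mem_cons_self
    have hA' : ∀ r ∈ A, r.1 ∈ Finset.Icc 1 m := fun r hr => hA r (List.mem_cons_of_mem _ hr)
    have hB' : ∀ r ∈ B, r.1 ∈ Finset.Icc 1 m := fun r hr => hB r (List.mem_cons_of_mem _ hr)
    have h2 := div_le_natDiv_add_one (min p.2 q.2 * 2 * S) (p.1 * q.1)
      (Nat.mul_pos (Finset.mem_Icc.1 hp).1 (Finset.mem_Icc.1 hq).1)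
    have h3 : S * ((min p.2 q.2 : ℕ) * (X p.1 + X q.1)) ≤
        ((min p.2 q.2 * 2 * S : ℕ) : ℝ) / ((p.1 * q.1 : ℕ) : ℝ) := by
      calc S * ((min p.2 q.2 : ℕ) * (X p.1 + X q.1))
          ≤ S * ((min p.2 q.2 : ℕ) * (2 / ((p.1 : ℝ) * q.1))) := by
            gcongr; exact hX _ hp _ hq
        _ = _ := by push_cast; ring
    rw [pairingCost]
    split_ifs with hpq
    · have ih := ihA hA' (List.forall_mem_cons.2 ⟨hq, hB'⟩)
      rw [min_eq_left hpq] at h2 h3 ⊢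
      simp only [runsValue_cons] at ih ⊢
      push_cast [Nat.cast_sub hpq] at h2 h3 ih ⊢
      linarith
    · have hqp : q.2 ≤ p.2 := (not_le.1 hpq).le
      have ih := ihB (List.forall_mem_cons.2 ⟨hp, hA'⟩) hB'
      rw [min_eq_right hqp] at h2 h3 ⊢
      simp only [runsValue_cons] at ih ⊢
      push_cast [Nat.cast_sub hqp] at h2 h3 ih ⊢
      linarith
  | case2 t A B h =>
    rw [pairingCost]
    · have h1 := mul_runsValue_le_remainderCost hX S A hA
      have h2 := mul_runsValue_le_remainderCost hX S B hB
      push_cast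
      linarith
    · exact h

theorem runsValue_totientRuns (X : ℕ → ℝ) (m : ℕ) :
    runsValue X (totientRuns m) = ∑ k ∈ Finset.Icc 1 m, (Nat.totient k : ℝ) * X k := by
  rw [runsValue, totientRuns, List.map_map]
  induction m with
  | zero => simp
  | succ m ih =>
    rw [List.range_succ, List.map_append, List.sum_append, ih,
      Finset.sum_Icc_succ_top (by omega)]
    simp

theorem sum_totient_mul_le_of_small {m : ℕ} (hm : 4 ≤ m) (hm' : m < 176) {X : ℕ → ℝ}
    (hX : PairBounded m X) : ∑ k ∈ Finset.Icc 1 m, (Nat.totient k : ℝ) * X k ≤ 0.999 := by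
  have hmem : ∀ p ∈ totientRuns m, p.1 ∈ Finset.Icc 1 m := by
    intro p hp
    obtain ⟨i, hi, rfl⟩ := List.mem_map.1 hp
    have := List.mem_range.1 hi
    simp; omega
  have h := mul_runsValue_add_le_pairingCost hX 1000000 (2 * m) (totientRuns m)
    (totientRuns m).reverse hmem (fun p hp => hmem p (List.mem_reverse.1 hp))
  have hrev : runsValue X (totientRuns m).reverse = runsValue X (totientRuns m) := by
    rw [runsValue, runsValue, List.map_reverse, List.sum_reverse]
  have hb : ((pairingCost 1000000 (2 * m) (totientRuns m) (totientRuns m).reverse : ℕ) : ℝ) ≤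
      1998000 := by exact_mod_cast pairingCost_bound_small m hm' hm
  rw [hrev, runsValue_totientRuns] at h
  push_cast at h
  linarith

/-! ### Coprime pairs in a short square -/

/-- Multiples of `n` in an interval of `L` consecutive integers: with `c` of them, the outermost
two differ by `(c - 1) n ≤ L - 1`. -/
theorem card_filter_dvd_mul_le (a L n : ℕ) (hn : 0 < n) (hL : 0 < L) :
    n * ((Finset.Ioc a (a + L)).filter (n ∣ ·)).card ≤ L + n - 1 := by
  have h : ((Finset.Ioc a (a + L)).filter (n ∣ ·)).card = (a + L) / n - a / n := by
    have h1 := Nat.Ioc_filter_dvd_card_eq_div (a + L) n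
    rw [← Finset.Ioc_union_Ioc_eq_Ioc (Nat.zero_le a) (Nat.le_add_right a L),
      Finset.filter_union, Finset.card_union_of_disjoint, Nat.Ioc_filter_dvd_card_eq_div] at h1
    · omega
    · exact (Finset.disjoint_filter_filter (Finset.Ioc_disjoint_Ioc_of_le le_rfl))
  rw [h, Nat.mul_sub]
  have h1 := Nat.mul_div_le (a + L) n
  have h2 := Nat.lt_mul_div_succ a hn
  rw [Nat.mul_add, Nat.mul_one] at h2
  omega

theorem card_offDiag_filter_dvd_le (a L n : ℕ) (hn : 0 < n) (hL : 0 < L) :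
    (((Finset.Ioc a (a + L)).filter (n ∣ ·)).offDiag.card : ℝ) ≤
      ((L : ℝ) + n - 1) * (L - 1) / (n : ℝ) ^ 2 := by
  rw [Finset.offDiag_card]
  set c := ((Finset.Ioc a (a + L)).filter (n ∣ ·)).card with hc
  have h := card_filter_dvd_mul_le a L n hn hL
  rw [← hc] at h
  have hnR : (1 : ℝ) ≤ n := by exact_mod_cast hn
  have hLR : (1 : ℝ) ≤ L := by exact_mod_cast hL
  have hR : (n : ℝ) * c ≤ L + n - 1 := by
    have : n * c + 1 ≤ L + n := by omega
    have : (n : ℝ) * c + 1 ≤ L + n := by exact_mod_cast this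
    linarith
  rw [Nat.cast_sub (Nat.le_mul_self c), le_div_iff₀ (by positivity)]
  push_cast
  rcases Nat.eq_zero_or_pos c with h0 | h0
  · rw [h0]; simp; nlinarith
  · have hcR : (1 : ℝ) ≤ c := by exact_mod_cast h0
    calc ((c : ℝ) * c - c) * (n : ℝ) ^ 2 = (n * c) * (n * c - n) := by ring
      _ ≤ (L + n - 1) * (L - 1) := by
        apply mul_le_mul hR (by linarith) (by nlinarith) (by linarith)

/-- Two distinct integers of an interval of length `L` that are not coprime share a factor which is
`2`, `3`, or an odd number `2 j + 5 < L`. -/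
theorem not_coprime_mem_offDiag {a L k l : ℕ} (hk : k ∈ Finset.Ioc a (a + L))
    (hl : l ∈ Finset.Ioc a (a + L)) (hkl : k ≠ l) (h : ¬ k.Coprime l) :
    (2 ∣ k ∧ 2 ∣ l) ∨ (3 ∣ k ∧ 3 ∣ l) ∨ ∃ j < L, 2 * j + 5 < L ∧ 2 * j + 5 ∣ k ∧ 2 * j + 5 ∣ l := by
  obtain ⟨p, hp, hpk, hpl⟩ := Nat.Prime.not_coprime_iff_dvd.1 h
  rw [Finset.mem_Ioc] at hk hl
  have hpL : p < L := by
    rcases lt_or_gt_of_ne hkl with h' | h'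
    · have := Nat.le_of_dvd (by omega) (Nat.dvd_sub hpl hpk); omega
    · have := Nat.le_of_dvd (by omega) (Nat.dvd_sub hpk hpl); omega
  rcases hp.eq_two_or_odd with rfl | hodd
  · exact Or.inl ⟨hpk, hpl⟩
  · by_cases h3 : p = 3
    · subst h3; exact Or.inr (Or.inl ⟨hpk, hpl⟩)
    · have := hp.two_le
      obtain ⟨j, rfl⟩ : ∃ j, p = 2 * j + 5 := ⟨(p - 5) / 2, by omega⟩
      exact Or.inr (Or.inr ⟨j, by omega, hpL, hpk, hpl⟩)

/-- Telescoping, from `1 / n² ≤ 1 / ((n - 1) (n + 1))`. -/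
theorem sum_one_div_odd_sq_le (N : ℕ) :
    ∑ j ∈ Finset.range N, 1 / (2 * (j : ℝ) + 5) ^ 2 ≤ 1 / 8 := by
  have h : ∀ N : ℕ, ∑ j ∈ Finset.range N, 1 / (2 * (j : ℝ) + 5) ^ 2 ≤
      1 / 8 - 1 / (4 * ((N : ℝ) + 2)) := by
    intro N
    induction N with
    | zero => norm_num
    | succ N ih =>
      rw [Finset.sum_range_succ]
      have : 1 / (2 * (N : ℝ) + 5) ^ 2 ≤
          1 / (4 * ((N : ℝ) + 2)) - 1 / (4 * ((N : ℝ) + 1 + 2)) := by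
        rw [div_sub_div _ _ (by positivity) (by positivity),
          div_le_div_iff₀ (by positivity) (by positivity)]
        nlinarith
      push_cast
      linarith
  refine (h N).trans ?_
  have : 0 ≤ 1 / (4 * ((N : ℝ) + 2)) := by positivity
  linarith

/-- The ordered coprime pairs of elements of the interval `(a, a + L]`. -/
def coprimeBox (a L : ℕ) : Finset (ℕ × ℕ) :=
  (Finset.Ioc a (a + L) ×ˢ Finset.Ioc a (a + L)).filter fun p => p.1.Coprime p.2

/-- Density of coprime pairs in a short square, by a union bound over the diagonal and over common
factors: `7 / 18 = 1 - 1 / 4 - 1 / 9 - 2 / 8`, the last term coming from all odd factors from `5` on. -/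
theorem le_card_coprimeBox (a L : ℕ) (hL : 0 < L) :
    7 / 18 * (L : ℝ) ^ 2 - 10 / 9 * L ≤ ((coprimeBox a L).card : ℝ) := by
  classical
  set I := Finset.Ioc a (a + L) with hI
  set M : ℕ → Finset (ℕ × ℕ) := fun n => (I.filter (n ∣ ·)).offDiag with hM
  have hsub : (I ×ˢ I) ⊆ coprimeBox a L ∪ (I.diag ∪ (M 2 ∪ (M 3 ∪
      ((Finset.range L).filter (fun j => 2 * j + 5 < L)).biUnion fun j => M (2 * j + 5)))) := by
    rintro ⟨k, l⟩ hkl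
    obtain ⟨hk, hl⟩ := Finset.mem_product.1 hkl
    by_cases hc : k.Coprime l
    · exact Finset.mem_union_left _ (Finset.mem_filter.2 ⟨hkl, hc⟩)
    refine Finset.mem_union_right _ ?_
    by_cases he : k = l
    · subst he; exact Finset.mem_union_left _ (Finset.mem_diag.2 ⟨hk, rfl⟩)
    refine Finset.mem_union_right _ ?_
    have hmem : ∀ n, n ∣ k → n ∣ l → (k, l) ∈ M n := fun n h1 h2 =>
      Finset.mem_offDiag.2 ⟨Finset.mem_filter.2 ⟨hk, h1⟩, Finset.mem_filter.2 ⟨hl, h2⟩, he⟩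
    rcases not_coprime_mem_offDiag hk hl he hc with ⟨h1, h2⟩ | ⟨h1, h2⟩ | ⟨j, hj, hj', h1, h2⟩
    · exact Finset.mem_union_left _ (hmem 2 h1 h2)
    · exact Finset.mem_union_right _ (Finset.mem_union_left _ (hmem 3 h1 h2))
    · exact Finset.mem_union_right _ (Finset.mem_union_right _ (Finset.mem_biUnion.2
        ⟨j, Finset.mem_filter.2 ⟨Finset.mem_range.2 hj, hj'⟩, hmem _ h1 h2⟩))
  have hcard := Finset.card_le_card hsub
  have u1 := Finset.card_union_le (coprimeBox a L) (I.diag ∪ (M 2 ∪ (M 3 ∪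
      ((Finset.range L).filter (fun j => 2 * j + 5 < L)).biUnion fun j => M (2 * j + 5))))
  have u2 := Finset.card_union_le I.diag (M 2 ∪ (M 3 ∪
      ((Finset.range L).filter (fun j => 2 * j + 5 < L)).biUnion fun j => M (2 * j + 5)))
  have u3 := Finset.card_union_le (M 2) (M 3 ∪
      ((Finset.range L).filter (fun j => 2 * j + 5 < L)).biUnion fun j => M (2 * j + 5))
  have u4 := Finset.card_union_le (M 3)
      (((Finset.range L).filter (fun j => 2 * j + 5 < L)).biUnion fun j => M (2 * j + 5))
  have u5 := Finset.card_biUnion_le (s := (Finset.range L).filter (fun j => 2 * j + 5 < L))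
    (t := fun j => M (2 * j + 5))
  have hIc : I.card = L := by simp [hI]
  rw [Finset.card_product, hIc] at hcard
  rw [Finset.diag_card, hIc] at u2
  have hall : L * L ≤ (coprimeBox a L).card + (L + ((M 2).card + ((M 3).card +
      ∑ j ∈ (Finset.range L).filter (fun j => 2 * j + 5 < L), (M (2 * j + 5)).card))) := by
    omega
  have hallR : (L : ℝ) * L ≤ (coprimeBox a L).card + (L + ((M 2).card + ((M 3).card +
      ∑ j ∈ (Finset.range L).filter (fun j => 2 * j + 5 < L), ((M (2 * j + 5)).card : ℝ)))) := by
    exact_mod_cast hall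
  have b2 := card_offDiag_filter_dvd_le a L 2 (by norm_num) hL
  have b3 := card_offDiag_filter_dvd_le a L 3 (by norm_num) hL
  have hLR : (1 : ℝ) ≤ L := by exact_mod_cast hL
  have btail : ∑ j ∈ (Finset.range L).filter (fun j => 2 * j + 5 < L),
      ((M (2 * j + 5)).card : ℝ) ≤ 2 * (L : ℝ) ^ 2 * (1 / 8) := by
    calc ∑ j ∈ (Finset.range L).filter (fun j => 2 * j + 5 < L), ((M (2 * j + 5)).card : ℝ)
        ≤ ∑ j ∈ (Finset.range L).filter (fun j => 2 * j + 5 < L),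
            2 * (L : ℝ) ^ 2 * (1 / (2 * (j : ℝ) + 5) ^ 2) := by
          refine Finset.sum_le_sum fun j hj => ?_
          have hj' : 2 * j + 5 < L := (Finset.mem_filter.1 hj).2
          have hjR : 2 * (j : ℝ) + 5 ≤ L := by exact_mod_cast hj'.le
          refine (card_offDiag_filter_dvd_le a L (2 * j + 5) (by omega) hL).trans ?_
          push_cast
          rw [mul_one_div]
          -- The bound `(L + n - 1) (L - 1) ≤ 2 L²`, valid for factors `n ≤ L`, keeps the tail
          -- proportional to `L²`.
          refine div_le_div_of_nonneg_right ?_ (by positivity)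
          nlinarith [mul_nonneg (sub_nonneg.2 hjR) (sub_nonneg.2 hLR)]
      _ ≤ ∑ j ∈ Finset.range L, 2 * (L : ℝ) ^ 2 * (1 / (2 * (j : ℝ) + 5) ^ 2) :=
          Finset.sum_le_sum_of_subset_of_nonneg (Finset.filter_subset _ _)
            fun _ _ _ => by positivity
      _ ≤ 2 * (L : ℝ) ^ 2 * (1 / 8) := by
          rw [← Finset.mul_sum]
          gcongr
          exact sum_one_div_odd_sq_le L
  push_cast at b2 b3
  have b2' : ((M 2).card : ℝ) ≤ (L + 2 - 1) * (L - 1) / 2 ^ 2 := b2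
  have b3' : ((M 3).card : ℝ) ≤ (L + 3 - 1) * (L - 1) / 3 ^ 2 := b3
  nlinarith

/-! ### Farey pairs -/

/-- The ordered pairs of coprime `k, l ≤ m` with `k + l > m`: the pairs of denominators of
neighbours in the Farey sequence of order `m`. -/
def fareyPairs (m : ℕ) : Finset (ℕ × ℕ) :=
  (Finset.Icc 1 m ×ˢ Finset.Icc 1 m).filter fun p => p.1.Coprime p.2 ∧ m < p.1 + p.2

theorem mem_fareyPairs {m k l : ℕ} :
    (k, l) ∈ fareyPairs m ↔ ((1 ≤ k ∧ k ≤ m) ∧ 1 ≤ l ∧ l ≤ m) ∧ k.Coprime l ∧ m < k + l := by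
  simp [fareyPairs]

/-- For `1 ≤ k ≤ m`, the partners of `k` are the numbers coprime to `k` among the `k` consecutive
integers of `(m - k, m]`. -/
theorem sum_fareyPairs_fst (m : ℕ) (X : ℕ → ℝ) :
    ∑ p ∈ fareyPairs m, X p.1 = ∑ k ∈ Finset.Icc 1 m, (Nat.totient k : ℝ) * X k := by
  rw [fareyPairs, Finset.sum_filter, Finset.sum_product]
  refine Finset.sum_congr rfl fun k hk => ?_
  obtain ⟨h1, h2⟩ := Finset.mem_Icc.1 hk
  dsimp only
  rw [← Finset.sum_filter, Finset.sum_const, nsmul_eq_mul,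
    ← Nat.filter_coprime_Ico_eq_totient k (m - k + 1)]
  congr 3
  ext l
  simp only [Finset.mem_filter, Finset.mem_Icc, Finset.mem_Ico]
  constructor
  · rintro ⟨h, hc, h'⟩; exact ⟨by omega, hc⟩
  · rintro ⟨h, hc⟩; exact ⟨by omega, hc, by omega⟩

theorem sum_fareyPairs_swap (m : ℕ) (f : ℕ × ℕ → ℝ) :
    ∑ p ∈ fareyPairs m, f p.swap = ∑ p ∈ fareyPairs m, f p := by
  refine Finset.sum_nbij' Prod.swap Prod.swap ?_ ?_ ?_ ?_ ?_
  · rintro ⟨k, l⟩ h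
    rw [mem_fareyPairs] at h
    exact mem_fareyPairs.2 ⟨⟨h.1.2, h.1.1⟩, h.2.1.symm, by omega⟩
  · rintro ⟨k, l⟩ h
    rw [mem_fareyPairs] at h
    exact mem_fareyPairs.2 ⟨⟨h.1.2, h.1.1⟩, h.2.1.symm, by omega⟩
  · simp
  · simp
  · simp

/-- Passing from `m` to `m + 1` replaces each `(k, l)` with `k + l = m + 1` by the mediant pairs
`(k, m + 1)` and `(m + 1, l)`, and `1 / (k l) = 1 / (k (k + l)) + 1 / ((k + l) l)`. -/
theorem sum_fareyPairs_one_div (m : ℕ) (hm : 1 ≤ m) :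
    ∑ p ∈ fareyPairs m, 1 / ((p.1 : ℝ) * p.2) = 1 := by
  induction m, hm using Nat.le_induction with
  | base =>
    have : fareyPairs 1 = {(1, 1)} := by decide
    simp [this]
  | succ m hm ih =>
    set K := (Finset.Icc 1 m).filter fun k => k.Coprime (m + 1) with hK
    set D := K.image fun k => (k, m + 1 - k) with hD
    set R := K.image fun k => (k, m + 1) with hR
    set U := K.image fun k => (m + 1, m + 1 - k) with hU
    set C := (fareyPairs m).filter fun p => m + 1 < p.1 + p.2 with hC
    have hcop : ∀ k, k ≤ m → ((k.Coprime (m + 1 - k)) ↔ k.Coprime (m + 1)) := by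
      intro k hk
      conv_rhs => rw [show m + 1 = (m + 1 - k) + k by omega]
      exact Nat.coprime_add_self_right.symm
    have hold : fareyPairs m = C ∪ D := by
      ext ⟨k, l⟩
      simp only [Finset.mem_union, hC, hD, hK, Finset.mem_filter, Finset.mem_image,
        mem_fareyPairs, Finset.mem_Icc, Prod.mk.injEq]
      constructor
      · rintro ⟨⟨hk, hl⟩, hc, h⟩
        by_cases h' : m + 1 < k + l
        · exact Or.inl ⟨⟨⟨hk, hl⟩, hc, h⟩, h'⟩
        · obtain rfl : l = m + 1 - k := by omega
          exact Or.inr ⟨k, ⟨hk, (hcop k hk.2).1 hc⟩, rfl, rfl⟩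
      · rintro (⟨h, -⟩ | ⟨k', ⟨hk, hc⟩, rfl, rfl⟩)
        · exact h
        · exact ⟨⟨hk, by omega⟩, (hcop k' hk.2).2 hc, by omega⟩
    have hnew : fareyPairs (m + 1) = C ∪ (R ∪ U) := by
      ext ⟨k, l⟩
      simp only [Finset.mem_union, hC, hR, hU, hK, Finset.mem_filter, Finset.mem_image,
        mem_fareyPairs, Finset.mem_Icc, Prod.mk.injEq]
      constructor
      · rintro ⟨⟨hk, hl⟩, hc, h⟩
        by_cases hkm : k = m + 1
        · by_cases hlm : l = m + 1
          · subst hkm hlm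
            rw [Nat.coprime_self] at hc
            omega
          · refine Or.inr (Or.inr ⟨m + 1 - l, ⟨by omega, ?_⟩, by omega, by omega⟩)
            rw [← hcop _ (by omega), show m + 1 - (m + 1 - l) = l by omega, Nat.coprime_comm,
              hcop l (by omega), Nat.coprime_comm, ← hkm]
            exact hc
        · by_cases hlm : l = m + 1
          · exact Or.inr (Or.inl ⟨k, ⟨by omega, hlm ▸ hc⟩, rfl, hlm.symm⟩)
          · exact Or.inl ⟨⟨by omega, hc, by omega⟩, h⟩
      · rintro (⟨h, h'⟩ | ⟨k', ⟨hk, hc⟩, rfl, rfl⟩ | ⟨k', ⟨hk, hc⟩, rfl, rfl⟩)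
        · exact ⟨by omega, h.2.1, h'⟩
        · exact ⟨by omega, hc, by omega⟩
        · refine ⟨by omega, ?_, by omega⟩
          rw [Nat.coprime_comm, ← hcop _ (by omega), show m + 1 - (m + 1 - k') = k' by omega,
            Nat.coprime_comm]
          exact (hcop k' hk.2).2 hc
    have hCD : Disjoint C D := by
      rw [Finset.disjoint_left]
      rintro ⟨k, l⟩ h1 h2
      simp only [hC, hD, hK, Finset.mem_filter, Finset.mem_image, Finset.mem_Icc,
        Prod.mk.injEq] at h1 h2
      obtain ⟨k', hk, rfl, rfl⟩ := h2
      omega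
    have hRU : Disjoint R U := by
      rw [Finset.disjoint_left]
      rintro ⟨k, l⟩ h1 h2
      simp only [hR, hU, hK, Finset.mem_filter, Finset.mem_image, Finset.mem_Icc,
        Prod.mk.injEq] at h1 h2
      obtain ⟨k', hk, rfl, rfl⟩ := h1
      obtain ⟨k'', hk', h⟩ := h2
      omega
    have hCRU : Disjoint C (R ∪ U) := by
      rw [Finset.disjoint_left]
      rintro ⟨k, l⟩ h1 h2
      simp only [hC, hR, hU, hK, Finset.mem_filter, Finset.mem_union, Finset.mem_image,
        mem_fareyPairs, Finset.mem_Icc, Prod.mk.injEq] at h1 h2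
      rcases h2 with ⟨k', hk, rfl, rfl⟩ | ⟨k', hk, rfl, rfl⟩ <;> omega
    have hmediant : ∑ p ∈ R, 1 / ((p.1 : ℝ) * p.2) + ∑ p ∈ U, 1 / ((p.1 : ℝ) * p.2) =
        ∑ p ∈ D, 1 / ((p.1 : ℝ) * p.2) := by
      rw [hR, hU, hD, Finset.sum_image, Finset.sum_image, Finset.sum_image,
        ← Finset.sum_add_distrib]
      · refine Finset.sum_congr rfl fun k hk => ?_
        simp only [hK, Finset.mem_filter, Finset.mem_Icc] at hk
        obtain ⟨⟨h1, h2⟩, -⟩ := hk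
        obtain ⟨l, hl⟩ : ∃ l, m + 1 = k + l := ⟨m + 1 - k, by omega⟩
        have hl0 : 1 ≤ l := by omega
        have hkR : (0 : ℝ) < k := by exact_mod_cast h1
        have hlR : (0 : ℝ) < l := by exact_mod_cast hl0
        simp only [hl, Nat.add_sub_cancel_left]
        push_cast
        field_simp
        ring
      · intro a _ b _ h; exact (Prod.mk.inj h).1
      · intro a ha b hb h
        simp only [hK, Finset.coe_filter, Finset.mem_Icc, Set.mem_ofPred_eq] at ha hb
        have := (Prod.mk.inj h).2
        omega
      · intro a _ b _ h; exact (Prod.mk.inj h).1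
    rw [hold, Finset.sum_union hCD] at ih
    rw [hnew, Finset.sum_union hCRU, Finset.sum_union hRU, hmediant, ih]

/-! ### Slack on the Farey pairs -/

/-- The slack of the constraint indexed by `p`. -/
noncomputable def slack (X : ℕ → ℝ) (p : ℕ × ℕ) : ℝ :=
  2 / ((p.1 : ℝ) * p.2) - (X p.1 + X p.2)

/-- Twice the distance of the objective value from `1` is the total slack on the Farey pairs. -/
theorem sum_slack_fareyPairs {m : ℕ} (hm : 1 ≤ m) (X : ℕ → ℝ) :
    ∑ p ∈ fareyPairs m, slack X p =
      2 - 2 * ∑ k ∈ Finset.Icc 1 m, (Nat.totient k : ℝ) * X k := by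
  have h1 := sum_fareyPairs_one_div m hm
  have h2 := sum_fareyPairs_fst m X
  have h3 := sum_fareyPairs_swap m fun p => X p.1
  simp only [Prod.fst_swap] at h3
  have h4 : ∑ p ∈ fareyPairs m, 2 / ((p.1 : ℝ) * p.2) = 2 := by
    simp only [show ∀ p : ℕ × ℕ, 2 / ((p.1 : ℝ) * p.2) = 2 * (1 / ((p.1 : ℝ) * p.2)) from
      fun p => by ring]
    rw [← Finset.mul_sum, h1, mul_one]
  simp only [slack, Finset.sum_sub_distrib, Finset.sum_add_distrib]
  rw [h4, h3, h2]
  ring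

theorem slack_nonneg {m : ℕ} {X : ℕ → ℝ} (hX : PairBounded m X) {k l : ℕ}
    (hk : k ∈ Finset.Icc 1 m) (hl : l ∈ Finset.Icc 1 m) : 0 ≤ slack X (k, l) :=
  sub_nonneg.2 (hX k hk l hl)

/-- Exchanging partners leaves `X k + X l + X k' + X l'` unchanged, so what the right-hand sides
lose in the exchange is a lower bound for the slack. -/
theorem two_mul_le_slack_add_slack {m : ℕ} {X : ℕ → ℝ} (hX : PairBounded m X) {k l k' l' : ℕ}
    (hk : k ∈ Finset.Icc 1 m) (hl : l ∈ Finset.Icc 1 m) (hk' : k' ∈ Finset.Icc 1 m)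
    (hl' : l' ∈ Finset.Icc 1 m) :
    2 * ((1 / (k : ℝ) - 1 / k') * (1 / (l : ℝ) - 1 / l')) ≤ slack X (k, l) + slack X (k', l') := by
  have h1 := hX k hk l' hl'
  have h2 := hX k' hk' l hl
  have e : ∀ a b : ℝ, 2 / (a * b) = 2 * (1 / a * (1 / b)) := fun a b => by
    rw [one_div_mul_one_div, mul_one_div]
  simp only [slack, e] at h1 h2 ⊢
  linarith

/-- If any value of `s` on `A` and any value of `s` on `B` add up to at least `g`, and both sets
have at least `n` elements, then `s` has total at least `n g` on `A` and `B`. -/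
theorem mul_le_sum_add_sum {ι : Type*} {A B : Finset ι} {s : ι → ℝ} {n g : ℝ} (hn : 0 ≤ n)
    (hA : n ≤ A.card) (hB : n ≤ B.card) (hne : A.Nonempty) (hsA : ∀ p ∈ A, 0 ≤ s p)
    (hsB : ∀ p ∈ B, 0 ≤ s p) (h : ∀ p ∈ A, ∀ q ∈ B, g ≤ s p + s q) :
    n * g ≤ ∑ p ∈ A, s p + ∑ q ∈ B, s q := by
  obtain ⟨p, hp, hmin⟩ := A.exists_min_image s hne
  have h1 : A.card * s p ≤ ∑ q ∈ A, s q := by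
    simpa using Finset.card_nsmul_le_sum A s (s p) hmin
  have h2 : B.card * (g - s p) ≤ ∑ q ∈ B, s q := by
    simpa using Finset.card_nsmul_le_sum B s (g - s p) fun q hq => by linarith [h p hp q hq]
  have h3 : 0 ≤ ∑ q ∈ B, s q := Finset.sum_nonneg hsB
  have h4 : n * s p ≤ A.card * s p := mul_le_mul_of_nonneg_right hA (hsA p hp)
  rcases le_total 0 (g - s p) with h5 | h5
  · have := mul_le_mul_of_nonneg_right hB h5
    linarith
  · have := mul_nonpos_of_nonneg_of_nonpos hn h5
    linarith

/-- The Farey pairs in `(m / 2, m / 2 + L]²` and in `(m - L, m]²`, where `L = ⌊m / 8⌋`, can be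
exchanged with each other at a gain of order `1 / m²`, and there are at least of order `m²` of both. -/
theorem sum_totient_mul_le_of_large {m : ℕ} (hm : 176 ≤ m) {X : ℕ → ℝ}
    (hX : PairBounded m X) : ∑ k ∈ Finset.Icc 1 m, (Nat.totient k : ℝ) * X k ≤ 0.999 := by
  set L := m / 8 with hL
  have hL22 : 22 ≤ L := by omega
  have hL8 : 8 * L ≤ m := by omega
  have hm8 : m ≤ 8 * L + 7 := by omega
  have hsum := sum_slack_fareyPairs (by omega : 1 ≤ m) X
  set A := coprimeBox (m / 2) L with hA
  set B := coprimeBox (m - L) L with hB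
  have memA : ∀ p ∈ A, (m / 2 < p.1 ∧ p.1 ≤ m / 2 + L) ∧ (m / 2 < p.2 ∧ p.2 ≤ m / 2 + L) ∧
      p.1.Coprime p.2 := by
    intro p hp
    simpa [hA, coprimeBox, and_assoc] using hp
  have memB : ∀ p ∈ B, (m - L < p.1 ∧ p.1 ≤ m - L + L) ∧ (m - L < p.2 ∧ p.2 ≤ m - L + L) ∧
      p.1.Coprime p.2 := by
    intro p hp
    simpa [hB, coprimeBox, and_assoc] using hp
  have hdisj : Disjoint A B := by
    rw [Finset.disjoint_left]
    intro p h1 h2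
    have := memA p h1
    have := memB p h2
    omega
  have hsub : A ∪ B ⊆ fareyPairs m := by
    rintro ⟨k, l⟩ h
    rw [mem_fareyPairs]
    rcases Finset.mem_union.1 h with h | h
    · obtain ⟨h1, h2, h3⟩ := memA _ h
      simp only at h1 h2 h3
      exact ⟨by omega, h3, by omega⟩
    · obtain ⟨h1, h2, h3⟩ := memB _ h
      simp only at h1 h2 h3
      exact ⟨by omega, h3, by omega⟩
  have hnonneg : ∀ p ∈ fareyPairs m, 0 ≤ slack X p := by
    rintro ⟨k, l⟩ h
    rw [mem_fareyPairs] at h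
    exact slack_nonneg hX (Finset.mem_Icc.2 h.1.1) (Finset.mem_Icc.2 h.1.2)
  have hmR : (176 : ℝ) ≤ m := by exact_mod_cast hm
  have hm0 : (0 : ℝ) < m := by linarith
  -- Elements of the two intervals lie below `5 m / 8` and above `7 m / 8`.
  have hgap : ∀ k k' : ℕ, m / 2 < k → k ≤ m / 2 + L → m - L < k' →
      16 / 35 / (m : ℝ) ≤ 1 / (k : ℝ) - 1 / k' := by
    intro k k' h0 h1 h2
    have hk0 : (0 : ℝ) < k := by exact_mod_cast (by omega : 0 < k)
    have hk : 8 * (k : ℝ) ≤ 5 * m := by exact_mod_cast (by omega : 8 * k ≤ 5 * m)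
    have hk' : 7 * (m : ℝ) ≤ 8 * k' := by exact_mod_cast (by omega : 7 * m ≤ 8 * k')
    have e1 : 8 / 5 / (m : ℝ) ≤ 1 / k := by
      rw [div_div, div_le_div_iff₀ (by positivity) hk0]; linarith
    have e2 : 1 / (k' : ℝ) ≤ 8 / 7 / m := by
      rw [div_div, div_le_div_iff₀ (by linarith) (by positivity)]; linarith
    have e3 : 16 / 35 / (m : ℝ) = 8 / 5 / m - 8 / 7 / m := by ring
    linarith
  have hexch : ∀ p ∈ A, ∀ q ∈ B, 2 * (16 / 35 / (m : ℝ)) ^ 2 ≤ slack X p + slack X q := by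
    rintro ⟨k, l⟩ hp ⟨k', l'⟩ hq
    obtain ⟨a1, a2, -⟩ := memA _ hp
    obtain ⟨b1, b2, -⟩ := memB _ hq
    simp only at a1 a2 b1 b2
    have hk := hgap k k' a1.1 a1.2 b1.1
    have hl := hgap l l' a2.1 a2.2 b2.1
    have hpos : 0 ≤ 16 / 35 / (m : ℝ) := by positivity
    refine le_trans ?_ (two_mul_le_slack_add_slack hX (k := k) (l := l) (k' := k') (l' := l')
      (Finset.mem_Icc.2 (by omega)) (Finset.mem_Icc.2 (by omega)) (Finset.mem_Icc.2 (by omega))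
      (Finset.mem_Icc.2 (by omega)))
    rw [pow_two]
    have := mul_le_mul hk hl hpos (hpos.trans hk)
    linarith
  set n : ℝ := 7 / 18 * (L : ℝ) ^ 2 - 10 / 9 * L with hn
  have hLR : (22 : ℝ) ≤ L := by exact_mod_cast hL22
  have hnpos : 0 < n := by rw [hn]; nlinarith
  have hnA : n ≤ A.card := le_card_coprimeBox _ _ (by omega)
  have hnB : n ≤ B.card := le_card_coprimeBox _ _ (by omega)
  have hne : A.Nonempty := by
    rw [← Finset.card_pos]
    exact_mod_cast hnpos.trans_le hnA
  have hslack := mul_le_sum_add_sum hnpos.le hnA hnB hne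
    (fun p hp => hnonneg p (hsub (Finset.mem_union_left _ hp)))
    (fun p hp => hnonneg p (hsub (Finset.mem_union_right _ hp))) hexch
  rw [← Finset.sum_union hdisj] at hslack
  have hle := Finset.sum_le_sum_of_subset_of_nonneg hsub fun p hp _ => hnonneg p hp
  -- This is where `m ≥ 176`, that is `L ≥ 22`, is needed; `m ≤ 8 L + 7` is the loss in `⌊m / 8⌋`.
  have hfinal : 0.002 ≤ n * (2 * (16 / 35 / (m : ℝ)) ^ 2) := by
    have hmL : (m : ℝ) ≤ 8 * L + 7 := by exact_mod_cast hm8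
    have hsq : (m : ℝ) ^ 2 ≤ (8 * L + 7) ^ 2 := by gcongr
    have e : n * (2 * (16 / 35 / (m : ℝ)) ^ 2) = n * (512 / 1225) / (m : ℝ) ^ 2 := by ring
    rw [e, le_div_iff₀ (by positivity), hn]
    nlinarith
  linarith

/-! ### The bound on the optimal value -/

theorem optValue_le {m : ℕ} (hm : 4 ≤ m) : optValue m ≤ 0.999 := by
  obtain ⟨x, ⟨-, hx⟩, hv⟩ := (isGreatest_optValue m).1
  -- An optimal point, reindexed by `1, …, m` and extended by `0` beyond `m`. At `k = 0` the
  -- truncated difference gives the junk value `x 0`, which is never used.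
  set X : ℕ → ℝ := fun k => if h : k - 1 < m then x ⟨k - 1, h⟩ else 0 with hXdef
  have hXi : ∀ i : Fin m, X (idx i) = x i := fun i => by simp [hXdef, idx]
  have hX : PairBounded m X := by
    intro k hk l hl
    rw [Finset.mem_Icc] at hk hl
    have h := hx ⟨k - 1, by omega⟩ ⟨l - 1, by omega⟩
    rw [← hXi, ← hXi] at h
    simpa [idx, Nat.sub_add_cancel hk.1, Nat.sub_add_cancel hl.1] using h
  have hobj : primalObjective m x = ∑ k ∈ Finset.Icc 1 m, (Nat.totient k : ℝ) * X k := by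
    simp only [primalObjective, ← hXi]
    refine (Fin.sum_univ_eq_sum_range (fun i => (Nat.totient (i + 1) : ℝ) * X (i + 1)) m).trans ?_
    refine Finset.sum_nbij' (· + 1) (· - 1) ?_ ?_ ?_ ?_ fun _ _ => rfl
    all_goals
      intro i hi
      simp only [Finset.mem_range, Finset.mem_Icc] at hi ⊢
      omega
  rw [← hv, hobj]
  rcases lt_or_ge m 176 with h | h
  · exact sum_totient_mul_le_of_small hm h hX
  · exact sum_totient_mul_le_of_large h hX

end GenericLP

/-- For every `m ≥ 4`, the value `z_m` is attained as the maximum of the primal program and as the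
minimum of the dual program, and `z_m ≤ 0.999`. -/
theorem mainTheorem6 (m : ℕ) (hm : 4 ≤ m) :
    IsGreatest (GenericLP.primalValues m) (GenericLP.optValue m) ∧
      IsLeast (GenericLP.dualValues m) (GenericLP.optValue m) ∧
      GenericLP.optValue m ≤ (0.999 : ℝ) :=
  ⟨GenericLP.isGreatest_optValue m, GenericLP.isLeast_dualValues m, GenericLP.optValue_le hm⟩
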